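/- Let $U:\mathbb R^n\to\mathbb R$ be a nonnegative $C^2$ function which is quasi-homogeneous with weight vector $\alpha=(\alpha_1,\dots,\alpha_n)\in\mathbb R^n$; that is, there is a real number $r$ such that $$U(\lambda^{\alpha_1}x_1,\dots,\lambda^{\alpha_n}x_n)=\lambda^{r}\,U(x_1,\dots,x_n)\qquad\text{for all }\lambda>0\text{ and all }x\in\mathbb R^n.$$ Let $V_\alpha\subset\mathbb R^n$ be the set of points $x$ such that $\alpha_i x_i\neq 0$ for some index $i$. Then every point $(p,0)$ of $(U^{-1}(0)\cap V_\alpha)\times\{0\}$ is a Lyapunov unstable equilibrium point of the Newtonian dynamics $\ddot x=-\nabla U(x)$ on the phase space $\mathbb R^n\times\mathbb R^n$ of positions and velocities $(x,\dot x)$; that is, $(p,0)$ is an equilibrium point and it is not Lyapunov stable in forward time. -/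

import Mathlib

noncomputable section

/-- `U` is quasi-homogeneous on `ℝⁿ` with weight vector `α`: for some real degree `r`,
`U (s ^ α₁ * x₁, …, s ^ αₙ * xₙ) = s ^ r * U (x₁, …, xₙ)` for all `s > 0` and all `x`.
The weights are arbitrary real numbers. -/
def IsQuasiHomogeneous {n : ℕ} (U : EuclideanSpace ℝ (Fin n) → ℝ) (α : Fin n → ℝ) : Prop :=
  ∃ r : ℝ, ∀ s : ℝ, 0 < s → ∀ x : EuclideanSpace ℝ (Fin n),
    U (WithLp.toLp 2 (fun i => s ^ α i * x i)) = s ^ r * U x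

/-- The set of points at which `x ↦ ∑ i, α i * x i ^ 2 / 2` is regular, that is, the set of
points with `α i * x i ≠ 0` for some `i`. -/
def regularSet {n : ℕ} (α : Fin n → ℝ) : Set (EuclideanSpace ℝ (Fin n)) :=
  {x | ∃ i, α i * x i ≠ 0}

/-- The vector field on the phase space `ℝⁿ × ℝⁿ` (position, velocity) of Newton's equation
`x'' = -∇U(x)`, that is, `x' = v`, `v' = -∇U(x)`. -/
def newtonField {n : ℕ} (U : EuclideanSpace ℝ (Fin n) → ℝ)
    (z : EuclideanSpace ℝ (Fin n) × EuclideanSpace ℝ (Fin n)) :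
    EuclideanSpace ℝ (Fin n) × EuclideanSpace ℝ (Fin n) :=
  (z.2, -gradient U z.1)

/-- `c` solves `z' = X(z)` on the time interval `[0, T)` (one-sided derivative at time `0`). -/
def IsForwardSolution {S : Type*} [NormedAddCommGroup S] [NormedSpace ℝ S]
    (X : S → S) (T : ℝ) (c : ℝ → S) : Prop :=
  ∀ t ∈ Set.Ico 0 T, HasDerivWithinAt c (X (c t)) (Set.Ico 0 T) t

/-- Lyapunov stability of the point `z₀` for `z' = X(z)`: every solution that starts close enough
to `z₀` stays close to `z₀` at all later times of its interval of existence. -/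
def IsLyapunovStable {S : Type*} [NormedAddCommGroup S] [NormedSpace ℝ S]
    (X : S → S) (z₀ : S) : Prop :=
  ∀ ε > 0, ∃ δ > 0, ∀ (T : ℝ) (c : ℝ → S), IsForwardSolution X T c → dist (c 0) z₀ < δ →
    ∀ t ∈ Set.Ico 0 T, dist (c t) z₀ < ε

/-- `z₀` is an equilibrium point of `z' = X(z)` and it is not Lyapunov stable. -/
def IsLyapunovUnstableEquilibrium {S : Type*} [NormedAddCommGroup S] [NormedSpace ℝ S]
    (X : S → S) (z₀ : S) : Prop :=
  X z₀ = 0 ∧ ¬ IsLyapunovStable X z₀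

end

open Set Metric InnerProductSpace

/-! ### Gluing and continuation of forward solutions -/

section ForwardSolutions

variable {S : Type*} [NormedAddCommGroup S] [NormedSpace ℝ S]

/-! Let `A = diag α` and `f x = ⟪A x, x⟫`. Along a solution `f' = 2⟪A x, v⟫`, and Euler's identity
gives `⟪A x, v⟫' = ⟪A v, v⟫ - r U(x)`. Since `U ≥ 0`, this is at least `-C E`, with `E` the
conserved energy and `C` a constant. Launch from `p` with velocity `ε A p`: the linear gain in `f`
has order `ε t` and the loss order `ε² t²`, so at a time of order `1/ε` the value of `f` has risen
by an amount independent of `ε`, which contradicts stability (`inner_weightMap_fst_ge`). These times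
are unbounded as `ε → 0`, so solutions must live that long; stability itself ensures this
(`exists_isForwardSolution`). -/

theorem IsForwardSolution.hasDerivWithinAt_Icc {X : S → S} {T τ : ℝ} {c : ℝ → S}
    (hc : IsForwardSolution X T c) (hτ : τ < T) {t : ℝ} (ht : t ∈ Icc 0 τ) :
    HasDerivWithinAt c (X (c t)) (Icc 0 τ) t :=
  (hc t ⟨ht.1, ht.2.trans_lt hτ⟩).mono fun _ hs => ⟨hs.1, hs.2.trans_lt hτ⟩

theorem isForwardSolution_of_hasDerivWithinAt_Icc {X : S → S} {T : ℝ} {c : ℝ → S}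
    (hc : ∀ t ∈ Icc 0 T, HasDerivWithinAt c (X (c t)) (Icc 0 T) t) : IsForwardSolution X T c :=
  fun t ht => (hc t (Ico_subset_Icc_self ht)).mono Ico_subset_Icc_self

/-- Two solutions on adjacent closed intervals that agree at the common end point concatenate. -/
theorem exists_hasDerivWithinAt_Icc_concat {X : S → S} {a b e : ℝ} (hab : a ≤ b) (hbe : b ≤ e)
    {c d : ℝ → S} (hc : ∀ t ∈ Icc a b, HasDerivWithinAt c (X (c t)) (Icc a b) t)
    (hd : ∀ t ∈ Icc b e, HasDerivWithinAt d (X (d t)) (Icc b e) t) (hcd : d b = c b) :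
    ∃ γ : ℝ → S, γ a = c a ∧ ∀ t ∈ Icc a e, HasDerivWithinAt γ (X (γ t)) (Icc a e) t := by
  classical
  set γ : ℝ → S := fun t => if t ≤ b then c t else d t with hγ
  have hl : ∀ t ≤ b, γ t = c t := fun t ht => if_pos ht
  have hr : ∀ t, b ≤ t → γ t = d t := fun t ht => by
    rcases ht.eq_or_lt with rfl | h
    · rw [hl b le_rfl, hcd]
    · exact if_neg h.not_ge
  refine ⟨γ, hl a hab, fun t ht => ?_⟩
  -- Off the closed half-interval the derivative within it is vacuous.
  have hleft : HasDerivWithinAt γ (X (γ t)) (Icc a b) t := by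
    by_cases h : t ≤ b
    · rw [hl t h]
      exact (hc t ⟨ht.1, h⟩).congr (fun s hs => hl s hs.2) (hl t h)
    · refine HasFDerivWithinAt.of_notMem_closure fun hmem => h ?_
      rw [isClosed_Icc.closure_eq] at hmem
      exact hmem.2
  have hright : HasDerivWithinAt γ (X (γ t)) (Icc b e) t := by
    by_cases h : b ≤ t
    · rw [hr t h]
      exact (hd t ⟨h, ht.2⟩).congr (fun s hs => hr s hs.1) (hr t h)
    · refine HasFDerivWithinAt.of_notMem_closure fun hmem => h ?_
      rw [isClosed_Icc.closure_eq] at hmem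
      exact hmem.1
  rw [← Icc_union_Icc_eq_Icc hab hbe]
  exact hleft.union hright

/-- Near a Lyapunov stable point of a `C¹` vector field, forward solutions exist for all times. -/
theorem IsLyapunovStable.exists_isForwardSolution [CompleteSpace S] {X : S → S} {z₀ : S}
    (hs : IsLyapunovStable X z₀) (hX : ContDiffAt ℝ 1 X z₀) :
    ∃ δ > 0, ∀ z, dist z z₀ < δ → ∀ T : ℝ, ∃ c : ℝ → S, c 0 = z ∧ IsForwardSolution X T c := by
  -- The existence time `h` is uniform over starting points in the closed `r`-ball; stability keeps
  -- solutions there, so steps of length `h` can be repeated.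
  obtain ⟨h, hh, a, r, L, K, hr, hP⟩ := IsPicardLindelof.of_contDiffAt_one hX
  obtain ⟨δ, hδ, hst⟩ := hs r (by exact_mod_cast hr)
  have hrpos : (0 : ℝ) < r := by exact_mod_cast hr
  refine ⟨min δ r, lt_min hδ hrpos, fun z hz T => ?_⟩
  have step : ∀ k : ℕ, ∃ c : ℝ → S, c 0 = z ∧
      ∀ t ∈ Icc 0 (k * h), HasDerivWithinAt c (X (c t)) (Icc 0 (k * h)) t := by
    intro k
    induction k with
    | zero =>
      refine ⟨fun _ => z, rfl, fun t ht => ?_⟩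
      have : Icc (0 : ℝ) ((0 : ℕ) * h) = {0} := by simp
      rw [this] at ht ⊢
      rw [mem_singleton_iff.1 ht]
      exact HasFDerivWithinAt.singleton
    | succ k ih =>
      obtain ⟨c, hc0, hc⟩ := ih
      set T₁ : ℝ := k * h with hT₁
      have hT₁0 : 0 ≤ T₁ := by positivity
      -- Stability speaks only of `t < T₁`; the end point follows by continuity, at the cost of
      -- closing the ball.
      have hmem : c T₁ ∈ closedBall z₀ (r : ℝ) := by
        rcases hT₁0.eq_or_lt with h0 | hpos
        · rw [← h0, hc0]
          exact (hz.trans_le (min_le_right _ _)).le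
        · have hcl : T₁ ∈ closure (Ico 0 T₁) := by
            rw [closure_Ico hpos.ne]
            exact ⟨hT₁0, le_rfl⟩
          have hcont : ContinuousWithinAt c (Ico 0 T₁) T₁ :=
            (hc T₁ ⟨hT₁0, le_rfl⟩).continuousWithinAt.mono Ico_subset_Icc_self
          have := hcont.mem_closure hcl (t := closedBall z₀ (r : ℝ)) fun t ht =>
            (hst T₁ c (isForwardSolution_of_hasDerivWithinAt_Icc hc)
              (by rw [hc0]; exact hz.trans_le (min_le_left _ _)) t ht).le
          rwa [isClosed_closedBall.closure_eq] at this
      obtain ⟨d, hd0, hd⟩ := (hP T₁).exists_eq_forall_mem_Icc_hasDerivWithinAt hmem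
      have hT₂ : ((k + 1 : ℕ) : ℝ) * h = T₁ + h := by rw [hT₁]; push_cast; ring
      rw [hT₂]
      obtain ⟨γ, hγ0, hγ⟩ := exists_hasDerivWithinAt_Icc_concat (X := X) hT₁0
        (by linarith : T₁ ≤ T₁ + h) hc
        (fun t ht => (hd t ⟨by linarith [ht.1], ht.2⟩).mono
          (Icc_subset_Icc_left (by linarith))) hd0
      exact ⟨γ, hγ0.trans hc0, hγ⟩
  obtain ⟨k, hk⟩ := exists_nat_ge (T / h)
  obtain ⟨c, hc0, hc⟩ := step k
  have hTk : T ≤ k * h := (div_le_iff₀ hh).1 hk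
  exact ⟨c, hc0, fun t ht => (isForwardSolution_of_hasDerivWithinAt_Icc hc t
    ⟨ht.1, ht.2.trans_le hTk⟩).mono (Ico_subset_Ico_right hTk)⟩

end ForwardSolutions

/-! ### Energy and virial estimates for Newton's equation -/

section Newton

variable {n : ℕ} {U : EuclideanSpace ℝ (Fin n) → ℝ}

/-- The diagonal linear map `x ↦ (α i * x i)`. -/
noncomputable def weightMap (α : Fin n → ℝ) :
    EuclideanSpace ℝ (Fin n) →L[ℝ] EuclideanSpace ℝ (Fin n) :=
  LinearMap.toContinuousLinearMap
    { toFun := fun x => WithLp.toLp 2 fun i => α i * x i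
      map_add' := fun x y => by ext i; simp [mul_add]
      map_smul' := fun s x => by ext i; simp [mul_left_comm] }

@[simp]
theorem weightMap_apply (α : Fin n → ℝ) (x : EuclideanSpace ℝ (Fin n)) (i : Fin n) :
    weightMap α x i = α i * x i := rfl

theorem inner_weightMap_left (α : Fin n → ℝ) (x y : EuclideanSpace ℝ (Fin n)) :
    inner ℝ (weightMap α x) y = inner ℝ x (weightMap α y) := by
  simp only [PiLp.inner_apply, weightMap_apply]
  exact Finset.sum_congr rfl fun i _ => by simp; ring

theorem weightMap_ne_zero {α : Fin n → ℝ} {x : EuclideanSpace ℝ (Fin n)}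
    (hx : x ∈ regularSet α) : weightMap α x ≠ 0 := by
  obtain ⟨i, hi⟩ := hx
  exact fun h => hi (by simpa using congrArg (fun y : EuclideanSpace ℝ (Fin n) => y i) h)

/-- Euler's identity for quasi-homogeneous functions. -/
theorem inner_gradient_weightMap {α : Fin n → ℝ} {r : ℝ}
    (hα : ∀ s : ℝ, 0 < s → ∀ x : EuclideanSpace ℝ (Fin n),
      U (WithLp.toLp 2 (fun i => s ^ α i * x i)) = s ^ r * U x)
    (hU : Differentiable ℝ U) (x : EuclideanSpace ℝ (Fin n)) :
    inner ℝ (gradient U x) (weightMap α x) = r * U x := by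
  set φ : ℝ → EuclideanSpace ℝ (Fin n) := fun s => WithLp.toLp 2 fun i => s ^ α i * x i with hφ
  have hφ1 : φ 1 = x := by ext i; simp [hφ]
  have hφ' : HasDerivAt φ (weightMap α x) 1 := by
    have hpi : HasDerivAt (fun (s : ℝ) (i : Fin n) => s ^ α i * x i) (fun i => α i * x i) 1 :=
      hasDerivAt_pi.2 fun i => by
        simpa using
          ((Real.hasDerivAt_rpow_const (p := α i) (Or.inl one_ne_zero)).mul_const (x i))
    exact (PiLp.continuousLinearEquiv 2 ℝ fun _ : Fin n => ℝ).symm.hasFDerivAt.comp_hasDerivAt 1 hpi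
  have hgrad : HasFDerivAt U (toDual ℝ _ (gradient U x)) (φ 1) := by
    rw [hφ1]; exact (hU x).hasGradientAt.hasFDerivAt
  have h1 := hgrad.comp_hasDerivAt 1 hφ'
  have h2 : HasDerivAt (fun s : ℝ => s ^ r * U x) (r * U x) 1 := by
    simpa using ((Real.hasDerivAt_rpow_const (x := 1) (p := r) (Or.inl one_ne_zero)).mul_const (U x))
  have h3 : U ∘ φ =ᶠ[nhds 1] fun s : ℝ => s ^ r * U x := by
    filter_upwards [lt_mem_nhds (zero_lt_one' ℝ)] with s hs using hα s hs x
  simpa using h1.unique (h2.congr_of_eventuallyEq h3)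

theorem contDiff_newtonField (hU : ContDiff ℝ 2 U) : ContDiff ℝ 1 (newtonField U) := by
  have hg : ContDiff ℝ 1 (gradient U) :=
    (toDual ℝ (EuclideanSpace ℝ (Fin n))).symm.toContinuousLinearEquiv.contDiff.comp
      (hU.fderiv_right (m := 1) (by norm_num))
  exact contDiff_snd.prodMk (hg.comp contDiff_fst).neg

variable {T τ : ℝ} {c : ℝ → EuclideanSpace ℝ (Fin n) × EuclideanSpace ℝ (Fin n)}

theorem IsForwardSolution.newton_fst (hc : IsForwardSolution (newtonField U) T c) (hτ : τ < T)
    {t : ℝ} (ht : t ∈ Icc 0 τ) :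
    HasDerivWithinAt (fun s => (c s).1) (c t).2 (Icc 0 τ) t :=
  (hc.hasDerivWithinAt_Icc hτ ht).fst

theorem IsForwardSolution.newton_snd (hc : IsForwardSolution (newtonField U) T c) (hτ : τ < T)
    {t : ℝ} (ht : t ∈ Icc 0 τ) :
    HasDerivWithinAt (fun s => (c s).2) (-gradient U (c t).1) (Icc 0 τ) t :=
  (hc.hasDerivWithinAt_Icc hτ ht).snd

/-- Conservation of energy. -/
theorem IsForwardSolution.newton_energy (hc : IsForwardSolution (newtonField U) T c) (hτ : τ < T)
    (hU : Differentiable ℝ U) {t : ℝ} (ht : t ∈ Icc 0 τ) :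
    ‖(c t).2‖ ^ 2 / 2 + U (c t).1 = ‖(c 0).2‖ ^ 2 / 2 + U (c 0).1 := by
  have hd : ∀ s ∈ Icc 0 τ, HasDerivWithinAt (fun s => ‖(c s).2‖ ^ 2 / 2 + U (c s).1) 0
      (Icc 0 τ) s := by
    intro s hs
    have h1 := ((hc.newton_snd hτ hs).norm_sq).div_const 2
    have h2 := ((hU (c s).1).hasGradientAt.hasFDerivAt).comp_hasDerivWithinAt s
      (hc.newton_fst hτ hs)
    refine (h1.add h2).congr_deriv ?_
    simp [inner_neg_right]
    ring
  exact constant_of_has_deriv_right_zero (fun s hs => (hd s hs).continuousWithinAt)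
    (fun s hs => (hd s (Ico_subset_Icc_self hs)).mono_of_mem_nhdsWithin
      (Icc_mem_nhdsGE_of_mem hs)) t ht

/-- As `U ≥ 0`, energy bounds both `‖v‖² / 2` and `U`, so the derivative `⟪A v, v⟫ - r U` is at
least `-(2‖A‖ + |r|) E ≥ -k`. -/
theorem IsForwardSolution.inner_weightMap_snd_ge {α : Fin n → ℝ} {r k : ℝ}
    (hα : ∀ s : ℝ, 0 < s → ∀ x : EuclideanSpace ℝ (Fin n),
      U (WithLp.toLp 2 (fun i => s ^ α i * x i)) = s ^ r * U x)
    (hU : Differentiable ℝ U) (hU0 : ∀ x, 0 ≤ U x)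
    (hc : IsForwardSolution (newtonField U) T c) (hτ : τ < T)
    (hk : (2 * ‖weightMap α‖ + |r|) * (‖(c 0).2‖ ^ 2 / 2 + U (c 0).1) ≤ k)
    {t : ℝ} (ht : t ∈ Icc 0 τ) :
    inner ℝ (weightMap α (c 0).1) (c 0).2 - k * t ≤ inner ℝ (weightMap α (c t).1) (c t).2 := by
  have hd : ∀ s ∈ Icc 0 τ,
      HasDerivWithinAt (fun s => inner ℝ (weightMap α (c s).1) (c s).2 + k * s)
        (inner ℝ (weightMap α (c s).2) (c s).2 - r * U (c s).1 + k) (Icc 0 τ) s := by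
    intro s hs
    have h1 := ((weightMap α).hasFDerivAt.comp_hasDerivWithinAt s (hc.newton_fst hτ hs)).inner ℝ
      (hc.newton_snd hτ hs)
    refine (h1.add ((hasDerivWithinAt_id s _).const_mul k)).congr_deriv ?_
    simp only [Function.comp_apply, inner_neg_right, ← inner_gradient_weightMap hα hU,
      real_inner_comm (weightMap α (c s).1) (gradient U (c s).1)]
    ring
  have hmono := monotoneOn_of_hasDerivWithinAt_nonneg (convex_Icc 0 τ)
    (fun s hs => (hd s hs).continuousWithinAt)
    (fun s hs => (hd s (interior_subset hs)).mono interior_subset) fun s hs => by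
      have hE := hc.newton_energy hτ hU (interior_subset hs)
      have hW : |inner ℝ (weightMap α (c s).2) (c s).2| ≤ ‖weightMap α‖ * ‖(c s).2‖ ^ 2 :=
        (abs_real_inner_le_norm _ _).trans <| by
          rw [pow_two, ← mul_assoc]
          gcongr
          exact (weightMap α).le_opNorm _
      have hr : r * U (c s).1 ≤ |r| * U (c s).1 :=
        mul_le_mul_of_nonneg_right (le_abs_self r) (hU0 _)
      have h1 := (abs_le.1 hW).1
      rw [← hE] at hk
      nlinarith [mul_nonneg (norm_nonneg (weightMap α)) (hU0 (c s).1),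
        mul_nonneg (abs_nonneg r) (sq_nonneg ‖(c s).2‖)]
  have := hmono ⟨le_rfl, ht.1.trans ht.2⟩ ht ht.1
  simp only [mul_zero, add_zero] at this
  linarith

/-- Integrates the previous bound once more, using that `A` is symmetric. -/
theorem IsForwardSolution.inner_weightMap_fst_ge {α : Fin n → ℝ} {r k : ℝ}
    (hα : ∀ s : ℝ, 0 < s → ∀ x : EuclideanSpace ℝ (Fin n),
      U (WithLp.toLp 2 (fun i => s ^ α i * x i)) = s ^ r * U x)
    (hU : Differentiable ℝ U) (hU0 : ∀ x, 0 ≤ U x)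
    (hc : IsForwardSolution (newtonField U) T c) (hτ : τ < T)
    (hk : (2 * ‖weightMap α‖ + |r|) * (‖(c 0).2‖ ^ 2 / 2 + U (c 0).1) ≤ k)
    {t : ℝ} (ht : t ∈ Icc 0 τ) :
    inner ℝ (weightMap α (c 0).1) (c 0).1 + 2 * inner ℝ (weightMap α (c 0).1) (c 0).2 * t
      - k * t ^ 2 ≤ inner ℝ (weightMap α (c t).1) (c t).1 := by
  set g₀ : ℝ := inner ℝ (weightMap α (c 0).1) (c 0).2 with hg₀
  have hd : ∀ s ∈ Icc 0 τ,
      HasDerivWithinAt (fun s => inner ℝ (weightMap α (c s).1) (c s).1 - 2 * g₀ * s + k * s ^ 2)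
        (2 * inner ℝ (weightMap α (c s).1) (c s).2 - 2 * g₀ + 2 * k * s) (Icc 0 τ) s := by
    intro s hs
    have hf := hc.newton_fst hτ hs
    have h1 := ((weightMap α).hasFDerivAt.comp_hasDerivWithinAt s hf).inner ℝ hf
    refine ((h1.sub ((hasDerivWithinAt_id s _).const_mul (2 * g₀))).add
      (((hasDerivWithinAt_id s _).pow 2).const_mul k)).congr_deriv ?_
    rw [inner_weightMap_left α (c s).2, real_inner_comm (weightMap α (c s).1)]
    simp
    ring
  have hmono := monotoneOn_of_hasDerivWithinAt_nonneg (convex_Icc 0 τ)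
    (fun s hs => (hd s hs).continuousWithinAt)
    (fun s hs => (hd s (interior_subset hs)).mono interior_subset) fun s hs => by
      have := hc.inner_weightMap_snd_ge hα hU hU0 hτ hk (interior_subset hs)
      linarith
  have := hmono ⟨le_rfl, ht.1.trans ht.2⟩ ht ht.1
  simp only [mul_zero, sub_zero, add_zero, ne_eq, OfNat.ofNat_ne_zero, not_false_eq_true,
    zero_pow] at this
  linarith

theorem not_isLyapunovStable_newtonField {α : Fin n → ℝ} (hU : ContDiff ℝ 2 U)
    (hU0 : ∀ x, 0 ≤ U x) (hα : IsQuasiHomogeneous U α) {p : EuclideanSpace ℝ (Fin n)}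
    (hp : U p = 0) (hreg : p ∈ regularSet α) : ¬ IsLyapunovStable (newtonField U) (p, 0) := by
  intro hs
  obtain ⟨r, hα⟩ := hα
  have hUd : Differentiable ℝ U := hU.differentiable (by norm_num)
  set w := weightMap α p with hw
  have hA : 0 < ‖w‖ := norm_pos_iff.2 (weightMap_ne_zero hreg)
  -- The launch energy is `ε² ‖w‖² / 2`, so `K * ε ^ 2` is an admissible `k`; the `+ 1` makes
  -- positivity immediate.
  set K : ℝ := (2 * ‖weightMap α‖ + |r|) * (‖w‖ ^ 2 / 2) + 1 with hK
  have hKpos : 0 < K := by positivity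
  set f : EuclideanSpace ℝ (Fin n) → ℝ := fun x => inner ℝ (weightMap α x) x with hf
  have hfc : Continuous f := (weightMap α).continuous.inner continuous_id
  have hgap : 0 < ‖w‖ ^ 4 / K := by positivity
  obtain ⟨ρ, hρ, hρf⟩ := Metric.continuousAt_iff.1 (hfc.continuousAt (x := p)) _ hgap
  obtain ⟨δ₁, hδ₁, hex⟩ := hs.exists_isForwardSolution (contDiff_newtonField hU).contDiffAt
  obtain ⟨δ₂, hδ₂, hst⟩ := hs ρ hρ
  obtain ⟨ε, hε, hεδ⟩ : ∃ ε > 0, ε * ‖w‖ < min δ₁ δ₂ := by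
    refine ⟨min δ₁ δ₂ / 2 / ‖w‖, by positivity, ?_⟩
    rw [div_mul_cancel₀ _ hA.ne']
    exact half_lt_self (lt_min hδ₁ hδ₂)
  have hz : dist ((p, ε • w) : EuclideanSpace ℝ (Fin n) × EuclideanSpace ℝ (Fin n)) (p, 0)
      < min δ₁ δ₂ := by
    simpa [Prod.dist_eq, norm_smul, abs_of_pos hε, hδ₁, hδ₂] using hεδ
  -- Maximizes `2 ε ‖w‖² t - K ε² t²`; the maximum `‖w‖ ^ 4 / K` does not involve `ε`.
  set τ : ℝ := ‖w‖ ^ 2 / (K * ε) with hτ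
  have hτ0 : 0 ≤ τ := by positivity
  -- Solutions live on half-open intervals, so `τ + 1` makes `τ` an admissible time.
  obtain ⟨c, hc0, hc⟩ := hex _ (hz.trans_le (min_le_left _ _)) (τ + 1)
  have hdist := hst _ c hc (by rw [hc0]; exact hz.trans_le (min_le_right _ _)) τ
    ⟨hτ0, lt_add_one τ⟩
  have hclose := hρf ((le_max_left _ _).trans_lt hdist)
  have hgrow := hc.inner_weightMap_fst_ge (k := K * ε ^ 2) hα hUd hU0 (lt_add_one τ) (by
    rw [hc0]
    simp only [hp, norm_smul, Real.norm_eq_abs, mul_pow, sq_abs, hK]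
    nlinarith [sq_nonneg ε]) ⟨hτ0, le_rfl⟩
  rw [hc0] at hgrow
  simp only [inner_smul_right, ← hw, real_inner_self_eq_norm_sq] at hgrow
  have hval : 2 * (ε * ‖w‖ ^ 2) * τ - K * ε ^ 2 * τ ^ 2 = ‖w‖ ^ 4 / K := by
    rw [hτ]; field_simp; ring
  have := (abs_lt.1 hclose).2
  simp only [hf, ← hw] at this
  linarith

end Newton

theorem corollary2 (n : ℕ) (U : EuclideanSpace ℝ (Fin n) → ℝ) (α : Fin n → ℝ)
    (hU : ContDiff ℝ 2 U) (hU_nonneg : ∀ x, 0 ≤ U x) (hα : IsQuasiHomogeneous U α) :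
    ∀ z ∈ (U ⁻¹' {0} ∩ regularSet α) ×ˢ ({0} : Set (EuclideanSpace ℝ (Fin n))),
      IsLyapunovUnstableEquilibrium (newtonField U) z := by
  rintro ⟨p, v⟩ ⟨⟨hp, hreg⟩, hv⟩
  obtain rfl : v = 0 := hv
  have hp : U p = 0 := hp
  refine ⟨?_, not_isLyapunovStable_newtonField hU hU_nonneg hα hp hreg⟩
  have hmin : IsLocalMin U p := Filter.Eventually.of_forall fun x => hp.trans_le (hU_nonneg x)
  simp [newtonField, gradient, hmin.fderiv_eq_zero]
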